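/- **Theorem (Pardue's conjecture for local cohomology).** For a field $\mathbb K$ let $A_{\mathbb K}=\mathbb K[X_1,\dots,X_n]$ with the standard grading and $\mathfrak m_{A_{\mathbb K}}=(X_1,\dots,X_n)$. A linear form $l$ is *filter-regular* for a graded $A_{\mathbb K}$-module $M=\bigoplus_{d\in\mathbb Z}M_d$ if multiplication by $l$, $M_d\to M_{d+1}$, is injective for all $d\gg 0$; linear forms $l_1,\dots,l_r$ form a *filter-regular sequence* for $M$ if $l_j$ is filter-regular for $M/(l_1,\dots,l_{j-1})M$ for $j=1,\dots,r$. A monomial ideal $I\subseteq A_{\mathbb K}$ is *weakly stable* if $X_n,X_{n-1},\dots,X_1$ is a filter-regular sequence for $A_{\mathbb K}/I$. If $I$ is generated by a set $S$ of monic monomials, then for a field $L$ let $I_L\subseteq A_L$ be the ideal generated by the same monomials. Let $\mathbb K$ be a field and $I\subseteq A_{\mathbb K}$ a weakly stable monomial ideal, generated by a set $S$ of monic monomials. Then for all $i\ge 0$ the Hilbert functions of the graded local cohomology modules agree, $$\operatorname{Hilb}\bigl(H^i_{\mathfrak m_{A_{\mathbb K}}}(A_{\mathbb K}/I)\bigr)=\operatorname{Hilb}\bigl(H^i_{\mathfrak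 m_{A_{\mathbb Q}}}(A_{\mathbb Q}/I_{\mathbb Q})\bigr),$$ that is, for every $j\in\mathbb Z$ the components of degree $j$ of the two modules are finite-dimensional, over $\mathbb K$ and over $\mathbb Q$ respectively, and have the same dimension. Moreover, the Hilbert function is independent of the base field: the same holds with $\mathbb Q$ replaced by any field $L$ and $I_{\mathbb Q}$ by $I_L$. -/

import Mathlib

noncomputable section

namespace GradedLC

/-! ### Filter-regular sequences of linear forms -/

section FilterRegular

variable {σ K M : Type*} [Field K] [AddCommGroup M] [Module (MvPolynomial σ K) M] [Module K M]
  [IsScalarTower K (MvPolynomial σ K) M]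

/-- A linear form `l` is filter-regular for the graded module `M = ⨁ 𝓜 d` if the multiplication
`M_d → M_{d+1}` by `l` is injective for all sufficiently large `d`. -/
def IsFilterRegular (𝓜 : ℤ → Submodule K M) (l : MvPolynomial σ K) : Prop :=
  l.IsHomogeneous 1 ∧ ∃ d₀ : ℤ, ∀ d, d₀ ≤ d → Set.InjOn (fun m : M => l • m) (𝓜 d : Set M)

/-- The grading induced on the quotient of a graded module by a submodule:
`(M / N)_d` is the image of `M_d`. -/
def quotientGrading (𝓜 : ℤ → Submodule K M) (N : Submodule (MvPolynomial σ K) M) (d : ℤ) :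
    Submodule K (M ⧸ N) :=
  (𝓜 d).map (N.mkQ.restrictScalars K)

/-- `l₁, …, l_r` is a filter-regular sequence for the graded module `M` if each `l_j` is
filter-regular for `M / (l₁, …, l_{j-1}) M`. -/
def IsFilterRegularSequence (𝓜 : ℤ → Submodule K M) {r : ℕ}
    (l : Fin r → MvPolynomial σ K) : Prop :=
  ∀ j : Fin r, IsFilterRegular
    (quotientGrading 𝓜
      (Ideal.span (l '' {k | k < j}) • (⊤ : Submodule (MvPolynomial σ K) M))) (l j)

end FilterRegular

/-! ### Monomial ideals and their quotients -/

section Monomial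

variable {σ : Type*} (K : Type*) [Field K]

/-- The standard grading of the polynomial ring, indexed by `ℤ`:
the polynomials that are homogeneous of degree `d`. -/
def polyGrading (d : ℤ) : Submodule K (MvPolynomial σ K) :=
  MvPolynomial.weightedHomogeneousSubmodule K (fun _ : σ => (1 : ℤ)) d

/-- The ideal of `K[X]` generated by the monic monomials with exponents in `s`. -/
def monomialIdeal (s : Set (σ →₀ ℕ)) : Ideal (MvPolynomial σ K) :=
  Ideal.span ((fun u => MvPolynomial.monomial u (1 : K)) '' s)

variable {K}

/-- The standard grading of `K[X] / I`. -/
def quotGrading (I : Ideal (MvPolynomial σ K)) : ℤ → Submodule K (MvPolynomial σ K ⧸ I) :=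
  quotientGrading (polyGrading K) I

/-- A monomial ideal `I` of `K[X₁, …, Xₙ]` is weakly stable if `Xₙ, …, X₁` is a filter-regular
sequence for `K[X₁, …, Xₙ] / I`. -/
def IsWeaklyStable {n : ℕ} (I : Ideal (MvPolynomial (Fin n) K)) : Prop :=
  (∃ s : Set (Fin n →₀ ℕ), I = monomialIdeal K s) ∧
    IsFilterRegularSequence (quotGrading I)
      (fun k : Fin n => (MvPolynomial.X k.rev : MvPolynomial (Fin n) K))

end Monomial

/-! ### The Čech complex and graded local cohomology

For elements `x₁, …, xₙ` of a commutative ring `R` and an `R`-module `M` the Čech complex is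
`0 → M → ⨁ M_{x_k} → ⨁ M_{x_k x_l} → ⋯ → M_{x₁ ⋯ xₙ} → 0`. If `R` is Noetherian, its `p`-th
cohomology is the local cohomology of `M` with support in the ideal `(x₁, …, xₙ)`; if `M` is
graded and the `x_k` are homogeneous, it carries the standard grading of local cohomology. -/

section Cech

variable {R : Type*} [CommRing R] {n : ℕ} (x : Fin n → R)

/-- The multiplicative set generated by the `x k`, `k ∈ S`; inverting it amounts to
inverting the product of the `x k`, `k ∈ S`. -/
def genSubmonoid (S : Finset (Fin n)) : Submonoid R :=
  Submonoid.closure (x '' (S : Set (Fin n)))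

lemma genSubmonoid_mono {S T : Finset (Fin n)} (h : S ⊆ T) :
    genSubmonoid x S ≤ genSubmonoid x T :=
  Submonoid.closure_mono (Set.image_mono (Finset.coe_subset.2 h))

variable (M : Type*) [AddCommGroup M] [Module R M]

/-- The localization `M_{x_S}` of `M` at the product of the `x k`, `k ∈ S`. -/
abbrev CechLoc (S : Finset (Fin n)) : Type _ := LocalizedModule (genSubmonoid x S) M

/-- The localization map `M_{x_S} → M_{x_T}` for `S ⊆ T`. -/
def cechLocMap {S T : Finset (Fin n)} (h : S ⊆ T) : CechLoc x M S →ₗ[R] CechLoc x M T :=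
  LocalizedModule.liftOfLE (genSubmonoid x S) (genSubmonoid x T) (genSubmonoid_mono x h)

lemma cechLocMap_cechLocMap {S T U : Finset (Fin n)} (h : S ⊆ T) (h' : T ⊆ U)
    (z : CechLoc x M S) :
    cechLocMap x M h' (cechLocMap x M h z) = cechLocMap x M (h.trans h') z := by
  suffices H : (cechLocMap x M h').comp (cechLocMap x M h) = cechLocMap x M (h.trans h') from
    LinearMap.congr_fun H z
  refine IsLocalizedModule.ext (genSubmonoid x S) (LocalizedModule.mkLinearMap _ M)
    (fun y => IsLocalizedModule.map_units (LocalizedModule.mkLinearMap (genSubmonoid x U) M)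
      ⟨y.1, genSubmonoid_mono x (h.trans h') y.2⟩) ?_
  ext m
  have e : ∀ {S T : Finset (Fin n)} (h : S ⊆ T), cechLocMap x M h
      (LocalizedModule.mkLinearMap (genSubmonoid x S) M m) =
      LocalizedModule.mkLinearMap (genSubmonoid x T) M m :=
    fun h => IsLocalizedModule.liftOfLE_apply _ _ (genSubmonoid_mono x h) _ _ m
  simp only [LinearMap.comp_apply, e]

/-- The `p`-cochains of the Čech complex: families of elements of `M_{x_S}`, `#S = p`. -/
abbrev CechCochain (p : ℕ) : Type _ :=
  (S : {S : Finset (Fin n) // S.card = p}) → CechLoc x M S.1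

/-- The Čech differential:
`(d c)_T = ∑_{k ∈ T} (-1) ^ #{l ∈ T | l < k} c_{T ∖ {k}}`, restricted to `M_{x_T}`. -/
def cechD (p : ℕ) : CechCochain x M p →ₗ[R] CechCochain x M (p + 1) :=
  LinearMap.pi fun T => ∑ k : {k // k ∈ T.1},
    ((-1 : R) ^ (T.1.filter (· < k.1)).card) •
      (cechLocMap x M (T.1.erase_subset k.1)).comp
        (LinearMap.proj (⟨T.1.erase k.1, by
          rw [Finset.card_erase_of_mem k.2, T.2, Nat.add_sub_cancel]⟩ :
          {S : Finset (Fin n) // S.card = p}))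

lemma cechD_apply (p : ℕ) (c : CechCochain x M p) (T) :
    cechD x M p c T = ∑ k : {k // k ∈ T.1},
      ((-1 : R) ^ (T.1.filter (· < k.1)).card) • cechLocMap x M (T.1.erase_subset k.1)
        (c ⟨T.1.erase k.1, by
          rw [Finset.card_erase_of_mem k.2, T.2, Nat.add_sub_cancel]⟩) := by
  simp only [cechD, LinearMap.pi_apply, LinearMap.sum_apply, LinearMap.smul_apply]
  rfl

/-- The Čech differentials form a complex. -/
lemma cechD_cechD (p : ℕ) (c : CechCochain x M p) : cechD x M (p + 1) (cechD x M p c) = 0 := by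
  classical
  funext T
  obtain ⟨T, hT⟩ := T
  set g : Finset (Fin n) → CechLoc x M T := fun S =>
    if h : S.card = p ∧ S ⊆ T then cechLocMap x M h.2 (c ⟨S, h.1⟩) else 0 with hg
  have key : cechD x M (p + 1) (cechD x M p c) ⟨T, hT⟩ =
      ∑ k ∈ T, ∑ l ∈ T.erase k, ((-1 : R) ^ (T.filter (· < k)).card *
        (-1 : R) ^ ((T.erase k).filter (· < l)).card) • g ((T.erase k).erase l) := by
    rw [cechD_apply, ← Finset.sum_coe_sort T]
    refine Finset.sum_congr rfl fun k _ => ?_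
    rw [cechD_apply, map_sum, Finset.smul_sum, ← Finset.sum_coe_sort (T.erase k.1)]
    refine Finset.sum_congr rfl fun l _ => ?_
    have h1 : ((T.erase k.1).erase l.1).card = p := by
      rw [Finset.card_erase_of_mem l.2, Finset.card_erase_of_mem k.2, hT]; rfl
    have h2 : (T.erase k.1).erase l.1 ⊆ T :=
      (Finset.erase_subset _ _).trans (Finset.erase_subset _ _)
    rw [map_smul, cechLocMap_cechLocMap, smul_smul]
    simp only [hg, h1, h2, and_self, dite_true]
  rw [key, Finset.sum_sigma']
  change _ = (0 : CechLoc x M T)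
  refine Finset.sum_involution (fun a _ => ⟨a.2, a.1⟩) ?_ ?_ ?_ ?_
  · rintro ⟨k, l⟩ h
    simp only [Finset.mem_sigma, Finset.mem_erase] at h
    obtain ⟨hk, hlk, hl⟩ := h
    dsimp only
    rw [Finset.erase_right_comm (a := l), ← add_smul]
    convert zero_smul R _ using 2
    have e : ∀ a ∈ T, ∀ b ∈ T, a < b →
        (T.filter (· < b)).card = ((T.erase a).filter (· < b)).card + 1 ∧
        (T.filter (· < a)).card = ((T.erase b).filter (· < a)).card := by
      intro a ha b hb hab
      constructor
      · rw [Finset.filter_erase, Finset.card_erase_add_one]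
        simp [ha, hab]
      · rw [Finset.filter_erase, Finset.erase_eq_of_notMem]
        simp [hab.le]
    rcases lt_or_gt_of_ne hlk with h | h
    · obtain ⟨e1, e2⟩ := e l hl k hk h
      rw [e1, e2]; ring
    · obtain ⟨e1, e2⟩ := e k hk l hl h
      rw [e1, e2]; ring
  · rintro ⟨k, l⟩ h _ h'
    simp only [Finset.mem_sigma, Finset.mem_erase] at h
    simp only [Sigma.mk.injEq, heq_eq_eq] at h'
    exact h.2.1 h'.1
  · rintro ⟨k, l⟩ h
    simp only [Finset.mem_sigma, Finset.mem_erase] at h ⊢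
    exact ⟨h.2.2, Ne.symm h.2.1, h.1⟩
  · rintro ⟨k, l⟩ h
    rfl

/-- The `p`-cocycles. -/
def cechCocycles (p : ℕ) : Submodule R (CechCochain x M p) :=
  LinearMap.ker (cechD x M p)

/-- The `p`-coboundaries. -/
def cechCoboundaries : (p : ℕ) → Submodule R (CechCochain x M p)
  | 0 => ⊥
  | p + 1 => LinearMap.range (cechD x M p)

/-- The `p`-th cohomology module of the Čech complex. -/
abbrev CechCohomology (p : ℕ) : Type _ :=
  cechCocycles x M p ⧸ (cechCoboundaries x M p).comap (cechCocycles x M p).subtype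

variable {M} {K : Type*} [Field K] [Algebra K R] [Module K M] [IsScalarTower K R M]
  (𝒜 : ℤ → Submodule K R) (𝓜 : ℤ → Submodule K M)

/-- The grading of `M_{x_S}` induced by gradings of `R` and `M`: the part of degree `j` is spanned
by the fractions `m / u` with `m` and `u` homogeneous and `deg m - deg u = j`. -/
def cechLocGrading (S : Finset (Fin n)) (j : ℤ) : Submodule K (CechLoc x M S) :=
  Submodule.span K {z | ∃ (d e : ℤ) (m : M) (u : genSubmonoid x S),
    m ∈ 𝓜 d ∧ (u : R) ∈ 𝒜 e ∧ d - e = j ∧ z = LocalizedModule.mk m u}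

/-- The cochains that are homogeneous of degree `j`. -/
def cechGrading (p : ℕ) (j : ℤ) : Submodule K (CechCochain x M p) :=
  Submodule.pi Set.univ fun S => cechLocGrading x 𝒜 𝓜 S.1 j

/-- The part of degree `j` of the `p`-th Čech cohomology: the classes of the cocycles that are
homogeneous of degree `j`. -/
def cechCohomologyGrading (p : ℕ) (j : ℤ) : Submodule K (CechCohomology x M p) :=
  ((cechGrading x 𝒜 𝓜 p j).comap ((cechCocycles x M p).subtype.restrictScalars K)).map
    (((cechCoboundaries x M p).comap (cechCocycles x M p).subtype).mkQ.restrictScalars K)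

end Cech

/-- The local cohomology module `H^i_𝔪(K[X₁, …, Xₙ] / I)`, where `𝔪 = (X₁, …, Xₙ)`. -/
abbrev LocalCohomology {n : ℕ} {K : Type*} [Field K] (I : Ideal (MvPolynomial (Fin n) K))
    (i : ℕ) : Type _ :=
  CechCohomology (MvPolynomial.X : Fin n → MvPolynomial (Fin n) K)
    (MvPolynomial (Fin n) K ⧸ I) i

/-- The part of degree `j` of the graded module `H^i_𝔪(K[X₁, …, Xₙ] / I)`. -/
def localCohomologyGrading {n : ℕ} {K : Type*} [Field K] (I : Ideal (MvPolynomial (Fin n) K))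
    (i : ℕ) (j : ℤ) : Submodule K (LocalCohomology I i) :=
  cechCohomologyGrading MvPolynomial.X (polyGrading K) (quotGrading I) i j

/-- The Hilbert function `j ↦ dim_K M_j` of a graded vector space. -/
def hilbertFunction {K V : Type*} [Field K] [AddCommGroup V] [Module K V]
    (𝓥 : ℤ → Submodule K V) (j : ℤ) : ℕ :=
  Module.finrank K (𝓥 j)

end GradedLC

end

open GradedLC

noncomputable section

namespace GradedLC

open Finset MvPolynomial

/-! ### Multidegrees of the localizations of `K[X] / I` -/

section Combinatorics

variable {n : ℕ} (s : Set (Fin n →₀ ℕ))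

/-! Every localization of `K[X]/I` in the Čech complex is graded by integer multidegrees, and each
graded piece has dimension 0 or 1. Which of the two occurs is the condition `Survives`, which
involves only the exponents in `s`. The Čech complex therefore splits into one scalar complex per
multidegree `a`, supported on the family of sets `S` where `a` survives (`scalarCochain_cechD`).
After removal of `negSupport a` from its members, this family is a simplicial complex. For a general
monomial ideal its cohomology could depend on the characteristic.

Weak stability leaves no room for that. It yields an exchange property of the exponents
(`IsWeaklyStable.isQuasiStable`). By `IsQuasiStable.trichotomy`, the family is then empty, or a
cone, or consists of `negSupport a` alone. The first two cases contribute nothing, the cone by an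
explicit contraction (`sum_coneContraction`); the third contributes one dimension in cohomological
degree `(negSupport a).card`. Thus the piece of degree `j` has dimension the cardinality of
`cohomologyDegrees s p j`, a finite set (`finite_cohomologyDegrees`) in whose definition no field
appears. -/

/-- The multidegree `a` occurs in the localization of `K[X] / I` at the variables in `S`, where `I`
is generated by the monomials with exponents in `s`. -/
def Survives (S : Finset (Fin n)) (a : Fin n → ℤ) : Prop :=
  (∀ i ∉ S, 0 ≤ a i) ∧ ∀ u ∈ s, ∃ i ∉ S, a i < u i

/-- The set of indices at which `a` is negative. -/
def negSupport (a : Fin n → ℤ) : Finset (Fin n) :=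
  univ.filter fun i => a i < 0

@[simp]
lemma mem_negSupport {a : Fin n → ℤ} {i : Fin n} : i ∈ negSupport a ↔ a i < 0 := by
  simp [negSupport]

/-- The multidegrees of total degree `j` in the `p`-th local cohomology of `K[X] / I` when `I` is
weakly stable. -/
def cohomologyDegrees (p : ℕ) (j : ℤ) : Set (Fin n → ℤ) :=
  {a | ∑ i, a i = j ∧ (negSupport a).card = p ∧ ∀ S, Survives s S a ↔ S = negSupport a}

/-- The combinatorial form of weak stability: if `X_j ^ t * w ∈ I` for some `t` and `i < j`, then
`X_i ^ t * w ∈ I` for some `t`. -/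
def IsQuasiStable : Prop :=
  ∀ i j : Fin n, i < j → ∀ w : Fin n → ℕ, (∃ u ∈ s, ∀ k, k ≠ j → u k ≤ w k) →
    ∃ u ∈ s, ∀ k, k ≠ i → u k ≤ w k

variable {s}

lemma Survives.negSupport_subset {S : Finset (Fin n)} {a : Fin n → ℤ} (h : Survives s S a) :
    negSupport a ⊆ S := fun i hi => by
  by_contra hS
  exact absurd (h.1 i hS) (not_le.2 (mem_negSupport.1 hi))

/-- This is what makes the survivors, taken modulo the negative support, a simplicial complex. -/
lemma Survives.anti {S T : Finset (Fin n)} {a : Fin n → ℤ} (h : Survives s T a) (hST : S ⊆ T)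
    (hS : negSupport a ⊆ S) : Survives s S a := by
  refine ⟨fun i hi => ?_, fun u hu => ?_⟩
  · by_contra h0
    exact hi (hS (mem_negSupport.2 (not_le.1 h0)))
  · obtain ⟨i, hi, hlt⟩ := h.2 u hu
    exact ⟨i, fun h' => hi (hST h'), hlt⟩

lemma not_survives_iff {S : Finset (Fin n)} {a : Fin n → ℤ} (hS : negSupport a ⊆ S) :
    ¬ Survives s S a ↔ ∃ u ∈ s, ∀ i ∉ S, (u i : ℤ) ≤ a i := by
  have h0 : ∀ i ∉ S, 0 ≤ a i := fun i hi => by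
    by_contra h
    exact hi (hS (mem_negSupport.2 (not_le.1 h)))
  simp only [Survives, not_and]
  constructor
  · intro h
    have := h h0
    push Not at this
    exact this
  · intro h _
    push Not
    exact h

/-- The exchange property, transported to multidegrees with negative entries. The entries on `S`
impose no condition, so there the comparison exponent can be `u` itself; off `S` the multidegree is
nonnegative and `toNat` loses nothing. -/
lemma IsQuasiStable.exists_le (hs : IsQuasiStable s) {i q : Fin n} (hiq : i < q)
    {S : Finset (Fin n)} {a : Fin n → ℤ} (hS : negSupport a ⊆ S)
    (h : ∃ u ∈ s, ∀ k ∉ insert q S, (u k : ℤ) ≤ a k) :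
    ∃ u ∈ s, ∀ k ∉ insert i S, (u k : ℤ) ≤ a k := by
  obtain ⟨u, hu, hle⟩ := h
  have h0 : ∀ i ∉ S, 0 ≤ a i := fun i hi => by
    by_contra h
    exact hi (hS (mem_negSupport.2 (not_le.1 h)))
  obtain ⟨v, hv, hle'⟩ := hs i q hiq (fun k => if k ∈ S then u k else (a k).toNat) ⟨u, hu, by
    intro k hk
    split_ifs with hkS
    · exact le_rfl
    · have := hle k (by simp [hk, hkS])
      omega⟩
  refine ⟨v, hv, fun k hk => ?_⟩
  simp only [mem_insert, not_or] at hk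
  have := hle' k hk.1
  rw [if_neg hk.2] at this
  have := h0 k hk.2
  omega

/-- For a quasi-stable set of exponents, the family of `S` in which a multidegree survives is
empty, or a cone, or consists of the negative support only. -/
lemma IsQuasiStable.trichotomy (hs : IsQuasiStable s) (a : Fin n → ℤ) :
    (∃ q, ∀ S, Survives s (insert q S) a ↔ Survives s S a) ∨
      (∀ S, Survives s S a ↔ S = negSupport a) ∨ ∀ S, ¬ Survives s S a := by
  by_cases hsing : ∀ S, Survives s S a → S = negSupport a
  · by_cases hG : Survives s (negSupport a) a
    · exact Or.inr (Or.inl fun S => ⟨hsing S, fun h => h ▸ hG⟩)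
    · exact Or.inr (Or.inr fun S h => hG (hsing S h ▸ h))
  left
  push Not at hsing
  obtain ⟨S₀, hS₀, hne⟩ := hsing
  obtain ⟨q₀, hq₀S, hq₀⟩ : ∃ q ∈ S₀, q ∉ negSupport a := by
    by_contra h
    push Not at h
    exact hne (Subset.antisymm h hS₀.negSupport_subset)
  have hq₀' : Survives s (insert q₀ (negSupport a)) a :=
    hS₀.anti (insert_subset hq₀S hS₀.negSupport_subset) (subset_insert _ _)
  have hnon : ((negSupport a)ᶜ).Nonempty := ⟨q₀, mem_compl.2 hq₀⟩
  -- The apex is the largest index outside the negative support, so that the exchange can trade it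
  -- for any other such index.
  set q := ((negSupport a)ᶜ).max' hnon with hq
  have hqG : q ∉ negSupport a := mem_compl.1 (max'_mem _ hnon)
  have hmax : ∀ k, k ∉ negSupport a → k ≤ q := fun k hk => le_max' _ _ (mem_compl.2 hk)
  refine ⟨q, fun S => ⟨fun h => h.anti (subset_insert _ _) fun i hi => ?_, fun h => ?_⟩⟩
  · refine (mem_insert.1 (h.negSupport_subset hi)).resolve_left ?_
    rintro rfl
    exact hqG hi
  · by_contra hcon
    have hGS := h.negSupport_subset
    have hle := (not_survives_iff (hGS.trans (subset_insert q S))).1 hcon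
    have hqS : q ∉ S := fun hqS => hcon (by rwa [insert_eq_of_mem hqS])
    -- A generator witnesses that `insert q S` fails. If `S` has an index below `q`, exchanging `q`
    -- for it makes `S` fail too. Otherwise `S` is the negative support, and exchanging `q` for `q₀`
    -- contradicts `hq₀'`.
    by_cases hi : ∃ i ∈ S, i < q
    · obtain ⟨i, hiS, hiq⟩ := hi
      have := hs.exists_le hiq hGS hle
      rw [insert_eq_of_mem hiS] at this
      exact (not_survives_iff hGS).2 this h
    · push Not at hi
      have hSG : S = negSupport a := by
        refine Subset.antisymm (fun i hiS => ?_) hGS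
        by_contra hiG
        exact hqS (le_antisymm (hi i hiS) (hmax i hiG) ▸ hiS)
      subst hSG
      rcases (hmax q₀ hq₀).lt_or_eq with hlt | heq
      · exact (not_survives_iff (subset_insert _ _)).2 (hs.exists_le hlt Subset.rfl hle) hq₀'
      · exact hcon (heq ▸ hq₀')

/-- Every set of exponents has a finite subset that generates the same monomial ideal. -/
lemma exists_finite_subset_le (s : Set (Fin n →₀ ℕ)) :
    ∃ t ⊆ s, t.Finite ∧ ∀ u ∈ s, ∃ v ∈ t, v ≤ u := by
  -- Dickson's lemma: the minimal exponents form an antichain in a well-quasi-order, hence a finite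
  -- set.
  have hwqo : WellQuasiOrderedLE (Fin n →₀ ℕ) := inferInstance
  refine ⟨{v | Minimal (· ∈ s) v}, fun v hv => hv.1, ?_, fun u hu => ?_⟩
  · exact (setOfPred_minimal_antichain _).finite_of_partiallyWellOrderedOn
      (Set.isPWO_of_wellQuasiOrderedLE _)
  · obtain ⟨v, hvu, hv⟩ := exists_minimal_le_of_wellFoundedLT (· ∈ s) u hu
    exact ⟨v, hv, hvu⟩

/-- Enlarging the negative support by `q` kills `a`, so some generator exceeds `a` at `q` only,
among the indices off the negative support. This bounds every entry above by the largest generator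
exponent `N`; the fixed total degree then bounds every entry below. -/
lemma finite_cohomologyDegrees (s : Set (Fin n →₀ ℕ)) (p : ℕ) (j : ℤ) :
    (cohomologyDegrees s p j).Finite := by
  obtain ⟨t, hts, htf, ht⟩ := exists_finite_subset_le s
  obtain ⟨N, hN⟩ : ∃ N : ℕ, ∀ u ∈ t, ∀ i, u i ≤ N := by
    refine ⟨∑ u ∈ htf.toFinset, ∑ i, u i, fun u hu i => ?_⟩
    calc u i ≤ ∑ i, u i := single_le_sum (f := fun i => u i) (fun _ _ => Nat.zero_le _) (mem_univ i)
      _ ≤ _ := single_le_sum (f := fun u : Fin n →₀ ℕ => ∑ i, u i) (fun _ _ => Nat.zero_le _)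
        (htf.mem_toFinset.2 hu)
  refine (Set.finite_Icc (fun _ : Fin n => j - n * N) fun _ : Fin n => (N : ℤ)).subset ?_
  rintro a ⟨hsum, -, hS⟩
  have hle : ∀ q, a q ≤ N := by
    intro q
    by_cases hq : a q < 0
    · omega
    have hqG : q ∉ negSupport a := fun h => hq (mem_negSupport.1 h)
    have h1 : ¬ Survives s (insert q (negSupport a)) a := fun h =>
      hqG (by have := (hS _).1 h; rw [← this]; exact mem_insert_self _ _)
    obtain ⟨u, hu, hua⟩ := (not_survives_iff (subset_insert _ _)).1 h1
    obtain ⟨v, hv, hvu⟩ := ht u hu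
    obtain ⟨i, hi, hlt⟩ := ((hS _).2 rfl).2 v (hts hv)
    have hiq : i = q := by
      by_contra hne
      have h2 := hua i (by simp only [mem_insert, not_or]; exact ⟨hne, hi⟩)
      have h3 := hvu i
      omega
    subst hiq
    have := hN v hv i
    omega
  refine ⟨fun q => ?_, hle⟩
  have h1 : ∑ i, ((N : ℤ) - a i) = n * N - j := by
    rw [sum_sub_distrib, hsum]
    simp
  have h2 : (N : ℤ) - a q ≤ ∑ i, ((N : ℤ) - a i) :=
    single_le_sum (f := fun i => (N : ℤ) - a i) (fun i _ => sub_nonneg.2 (hle i)) (mem_univ q)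
  dsimp only
  omega

end Combinatorics

/-! ### Signed cochains on a cone -/

section Cone

variable {n : ℕ} {R : Type*} [CommRing R]

/-- The sign of the face `T ∖ {k}` of `T` in the Čech differential. -/
def faceSign (R : Type*) [CommRing R] (T : Finset (Fin n)) (k : Fin n) : R :=
  (-1) ^ (T.filter (· < k)).card

lemma faceSign_mul_self (T : Finset (Fin n)) (k : Fin n) :
    faceSign R T k * faceSign R T k = 1 := by
  rw [faceSign, ← pow_add, ← two_mul, pow_mul]
  simp

/-- Removing `k` and `q` from `insert q T` in the two possible orders gives opposite signs, as in
`d² = 0`; the factors ±1 are rearranged for use in the contraction. -/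
lemma faceSign_insert_erase {T : Finset (Fin n)} {k q : Fin n} (hk : k ∈ T) (hq : q ∉ T) :
    faceSign R T k * faceSign R (insert q (T.erase k)) q =
      - (faceSign R (insert q T) q * faceSign R (insert q T) k) := by
  have hkq : k ≠ q := by rintro rfl; exact hq hk
  simp only [faceSign]
  rcases lt_or_gt_of_ne hkq with h | h
  · have e1 : (insert q T).filter (· < k) = T.filter (· < k) := by
      rw [filter_insert, if_neg h.le.not_gt]
    have e2 : ((insert q T).filter (· < q)).card =
        ((insert q (T.erase k)).filter (· < q)).card + 1 := by
      rw [filter_insert, if_neg (lt_irrefl q), filter_insert, if_neg (lt_irrefl q), filter_erase,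
        card_erase_add_one]
      simp [hk, h]
    rw [e1, e2]; ring
  · have e1 : ((insert q T).filter (· < k)).card = (T.filter (· < k)).card + 1 := by
      rw [filter_insert, if_pos h, card_insert_of_notMem]
      simp [hq]
    have e2 : (insert q T).filter (· < q) = (insert q (T.erase k)).filter (· < q) := by
      rw [filter_insert, if_neg (lt_irrefl q), filter_insert, if_neg (lt_irrefl q), filter_erase,
        erase_eq_of_notMem]
      simp [h.le]
    rw [e1, e2]; ring

/-- The contraction of the cochain `φ` along the vertex `q`. -/
def coneContraction (q : Fin n) (φ : Finset (Fin n) → R) (S : Finset (Fin n)) : R :=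
  if q ∈ S then 0 else faceSign R (insert q S) q * φ (insert q S)

/-- A cochain on a cone with apex `q` that satisfies the cocycle condition on `insert q T` is the
coboundary of its contraction. -/
lemma sum_coneContraction {q : Fin n} {φ : Finset (Fin n) → R} {T : Finset (Fin n)}
    (h : q ∉ T → ∑ k ∈ insert q T, faceSign R (insert q T) k * φ ((insert q T).erase k) = 0) :
    ∑ k ∈ T, faceSign R T k * coneContraction q φ (T.erase k) = φ T := by
  by_cases hq : q ∈ T
  -- The contraction vanishes on sets containing `q`, so only the face opposite `q` contributes.
  · rw [sum_eq_single_of_mem q hq]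
    · rw [coneContraction, if_neg (notMem_erase q T), insert_erase hq, ← mul_assoc,
        faceSign_mul_self, one_mul]
    · intro k _ hkq
      rw [coneContraction, if_pos (mem_erase.2 ⟨hkq.symm, hq⟩), mul_zero]
  · have h := h hq
    -- The cocycle condition on `insert q T` expresses `φ T` through the remaining faces.
    rw [sum_insert hq, erase_insert hq] at h
    have e : ∀ k ∈ T, faceSign R T k * coneContraction q φ (T.erase k) =
        - faceSign R (insert q T) q *
          (faceSign R (insert q T) k * φ ((insert q T).erase k)) := by
      intro k hk
      have hkq : q ≠ k := by rintro rfl; exact hq hk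
      rw [coneContraction, if_neg (fun h' => hq (mem_of_mem_erase h')), ← mul_assoc,
        faceSign_insert_erase hk hq, erase_insert_of_ne hkq]
      ring
    rw [sum_congr rfl e, ← mul_sum, ← neg_eq_of_add_eq_zero_right h]
    rw [neg_mul_neg, ← mul_assoc, faceSign_mul_self, one_mul]

end Cone

/-! ### Monomial ideals and weak stability -/

section WeaklyStable

variable {n : ℕ} {K : Type*} [Field K] {s : Set (Fin n →₀ ℕ)}

lemma mem_monomialIdeal {p : MvPolynomial (Fin n) K} :
    p ∈ monomialIdeal K s ↔ ∀ m ∈ p.support, ∃ u ∈ s, u ≤ m :=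
  mem_ideal_span_monomial_image

lemma monomial_mem_monomialIdeal {m : Fin n →₀ ℕ} {c : K} (hc : c ≠ 0) :
    monomial m c ∈ monomialIdeal K s ↔ ∃ u ∈ s, u ≤ m := by
  classical
  rw [mem_monomialIdeal, support_monomial, if_neg hc]
  simp

lemma monomialIdeal_mono {t : Set (Fin n →₀ ℕ)} (h : s ⊆ t) :
    monomialIdeal K s ≤ monomialIdeal K t :=
  Ideal.span_mono (Set.image_mono h)

/-- If `I` is weakly stable, multiplication by `X_j` reflects membership in `I` for monomials of
large degree in `X_1, …, X_j`. -/
lemma IsWeaklyStable.exists_forall_degree_le (hI : IsWeaklyStable (monomialIdeal K s))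
    (j : Fin n) :
    ∃ d₀ : ℕ, ∀ w : Fin n →₀ ℕ, (∀ k, j < k → w k = 0) → d₀ ≤ w.degree →
      (∃ u ∈ s, u ≤ w + Finsupp.single j 1) → ∃ u ∈ s, u ≤ w := by
  classical
  obtain ⟨-, d₀, hd⟩ := hI.2 j.rev
  refine ⟨d₀.toNat, fun w hw hdeg hmem => ?_⟩
  set I := monomialIdeal K s with hIdef
  set l : Fin n → MvPolynomial (Fin n) K := fun k => X k.rev with hl
  set N : Submodule (MvPolynomial (Fin n) K) (MvPolynomial (Fin n) K ⧸ I) :=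
    Ideal.span (l '' {k | k < j.rev}) • ⊤ with hN
  -- Modulo `N` the variables after `X_j` are killed, since `k < j.rev` means `j < k.rev`. Adjoining
  -- them to `s` turns membership in `N` into divisibility of monomials.
  set t : Set (Fin n →₀ ℕ) := s ∪ (fun k => Finsupp.single k 1) '' {k | j < k} with ht
  have hNle : N ≤ Submodule.map (Submodule.mkQ I) (monomialIdeal K t) := by
    rw [hN, Submodule.smul_le]
    intro r hr x _
    obtain ⟨p, rfl⟩ := Submodule.mkQ_surjective I x
    refine ⟨r * p, Ideal.mul_mem_right _ _ ?_, by rw [← smul_eq_mul, map_smul]⟩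
    refine (Ideal.span_le.2 ?_) hr
    rintro _ ⟨k, hk, rfl⟩
    refine Ideal.subset_span ⟨Finsupp.single k.rev 1, Or.inr ⟨k.rev, ?_, rfl⟩, rfl⟩
    simp only [Set.mem_ofPred_eq] at hk ⊢
    exact Fin.lt_rev_iff.2 hk
  set m : MvPolynomial (Fin n) K ⧸ I := Submodule.mkQ I (monomial w 1) with hm
  have hmI : m ∈ quotGrading I (w.degree : ℤ) := by
    refine ⟨monomial w 1, ?_, rfl⟩
    refine isWeightedHomogeneous_monomial _ _ _ ?_
    rw [Finsupp.weight_apply, Finsupp.degree_apply, Finsupp.sum]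
    simp
  have h1 : N.mkQ m ∈ quotientGrading (quotGrading I) N (w.degree : ℤ) := ⟨m, hmI, rfl⟩
  have h0 : l j.rev • m = 0 := by
    rw [hm, ← map_smul]
    refine (Submodule.Quotient.mk_eq_zero _).2 ?_
    rw [smul_eq_mul, hl]
    dsimp only
    rw [Fin.rev_rev, X, monomial_mul, one_mul, monomial_mem_monomialIdeal one_ne_zero, add_comm]
    exact hmem
  have h2 : N.mkQ m = 0 := by
    refine hd (w.degree : ℤ) (by omega) h1 (Submodule.zero_mem _) ?_
    change l j.rev • N.mkQ m = l j.rev • (0 : _ ⧸ N)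
    rw [← map_smul, h0, map_zero, smul_zero]
  have h3 : m ∈ N := (Submodule.Quotient.mk_eq_zero _).1 h2
  obtain ⟨p, hp, hpm⟩ := hNle h3
  have h4 : monomial w 1 - p ∈ I := (Submodule.Quotient.eq I).1 hpm.symm
  have h5 : (monomial w 1 : MvPolynomial (Fin n) K) ∈ monomialIdeal K t := by
    have := add_mem (monomialIdeal_mono Set.subset_union_left h4) hp
    rwa [sub_add_cancel] at this
  obtain ⟨u, hu | ⟨k, hk, rfl⟩, hle⟩ := (monomial_mem_monomialIdeal one_ne_zero).1 h5
  · exact ⟨u, hu, hle⟩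
  · have := hle k
    rw [Finsupp.single_eq_same, hw k hk] at this
    omega

/-- Multiplying by `X_i ^ d₀` reaches the degrees where division by `X_j` preserves membership in
`I`; the factors `X_j` are then stripped off one by one. As `i < j`, no variable beyond `X_j` is
introduced. -/
lemma IsWeaklyStable.exists_add_single_of_lt (hI : IsWeaklyStable (monomialIdeal K s))
    {i j : Fin n} (hij : i < j) {w : Fin n →₀ ℕ} (hw : ∀ k, j < k → w k = 0) {t : ℕ}
    (h : ∃ u ∈ s, u ≤ w + Finsupp.single j t) :
    ∃ t', ∃ u ∈ s, u ≤ w + Finsupp.single i t' := by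
  obtain ⟨d₀, hd⟩ := hI.exists_forall_degree_le j
  refine ⟨d₀, ?_⟩
  have key : ∀ t : ℕ, (∃ u ∈ s, u ≤ w + Finsupp.single i d₀ + Finsupp.single j t) →
      ∃ u ∈ s, u ≤ w + Finsupp.single i d₀ := by
    intro t
    induction t with
    | zero => simp
    | succ t ih =>
      intro ⟨u, hu, hle⟩
      refine ih (hd _ (fun k hk => ?_) ?_ ⟨u, hu, ?_⟩)
      · simp [hw k hk, hk.ne, (hij.trans hk).ne]
      · simp only [map_add, Finsupp.degree_single]
        omega
      · rwa [add_assoc, ← Finsupp.single_add]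
  obtain ⟨u, hu, hle⟩ := h
  refine key t ⟨u, hu, hle.trans ?_⟩
  rw [add_right_comm]
  exact le_self_add

/-- A weakly stable ideal is quasi-stable. -/
lemma IsWeaklyStable.isQuasiStable (hI : IsWeaklyStable (monomialIdeal K s)) :
    IsQuasiStable s := by
  classical
  intro i j hij w ⟨u, hu, hle⟩
  -- Induction on how far past `j` the variables of `v` extend. The last one, `X_m`, is traded for a
  -- power of `X_j`, which costs nothing because the exponent at `j` is erased in the conclusion.
  have key : ∀ r : ℕ, ∀ v : Fin n →₀ ℕ, (∀ k : Fin n, (j : ℕ) + r < k → v k = 0) →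
      (∃ u ∈ s, u ≤ v) → ∃ t, ∃ u ∈ s, u ≤ v.erase j + Finsupp.single i t := by
    intro r
    induction r with
    | zero =>
      intro v hv ⟨u, hu, hle⟩
      refine hI.exists_add_single_of_lt hij (w := v.erase j) (t := v j) (fun k hk => ?_)
        ⟨u, hu, by rwa [Finsupp.erase_add_single]⟩
      rw [Finsupp.erase_ne hk.ne']
      exact hv k (by simpa using hk)
    | succ r ih =>
      intro v hv ⟨u, hu, hle⟩
      by_cases hr : (j : ℕ) + (r + 1) < n
      · set m : Fin n := ⟨j + (r + 1), hr⟩ with hm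
        have hjm : j < m := by simp [Fin.lt_def, hm]
        obtain ⟨t, u', hu', hle'⟩ := hI.exists_add_single_of_lt hjm (w := v.erase m) (t := v m)
          (fun k hk => by
            rw [Finsupp.erase_ne hk.ne']
            exact hv k hk) ⟨u, hu, by rwa [Finsupp.erase_add_single]⟩
        obtain ⟨t', u'', hu'', hle''⟩ := ih (v.erase m + Finsupp.single j t) (fun k hk => by
            have hkj : j ≠ k := by rintro rfl; omega
            rw [Finsupp.add_apply, Finsupp.single_eq_of_ne' hkj, add_zero]
            by_cases hkm : k = m
            · rw [hkm, Finsupp.erase_same]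
            · rw [Finsupp.erase_ne hkm]
              refine hv k ?_
              have : (k : ℕ) ≠ j + (r + 1) := fun h => hkm (Fin.ext h)
              omega) ⟨u', hu', hle'⟩
        refine ⟨t', u'', hu'', hle''.trans (add_le_add_left ?_ _)⟩
        intro k
        by_cases hkj : k = j
        · simp [hkj]
        · by_cases hkm : k = m
          · rw [hkm, Finsupp.erase_ne hjm.ne', Finsupp.add_apply, Finsupp.erase_same,
              Finsupp.single_eq_of_ne hjm.ne']
            exact Nat.zero_le _
          · simp [Finsupp.erase_ne hkj, Finsupp.erase_ne hkm]
      · exact ih v (fun k hk => by have := k.2; omega) ⟨u, hu, hle⟩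
  -- With `r = n` the vanishing condition is void. The entry of `w` at `j` is replaced by `u j` so
  -- that `u` divides the whole monomial.
  obtain ⟨t, u', hu', hle'⟩ := key n
    (Finsupp.equivFunOnFinite.symm (Function.update w j (u j))) (fun k hk => by
      have := k.2; omega) ⟨u, hu, fun k => by
        by_cases hk : k = j
        · simp [hk]
        · simpa [Function.update_of_ne hk] using hle k hk⟩
  refine ⟨u', hu', fun k hk => ?_⟩
  have := hle' k
  rw [Finsupp.add_apply, Finsupp.single_eq_of_ne hk, add_zero] at this
  by_cases hkj : k = j
  · rw [hkj, Finsupp.erase_same] at this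
    rw [hkj]; omega
  · rw [Finsupp.erase_ne hkj] at this
    simpa [Function.update_of_ne hkj] using this

end WeaklyStable

/-! ### Coefficients of fractions -/

section Coefficients

variable {n : ℕ} {K : Type*} [Field K] {s : Set (Fin n →₀ ℕ)} {S T : Finset (Fin n)}
  {a : Fin n → ℤ}

open Classical in
/-- The coefficient of a polynomial at an integral exponent. -/
def laurentCoeff (a : Fin n → ℤ) : MvPolynomial (Fin n) K →ₗ[K] K :=
  if 0 ≤ a then lcoeff K (Finsupp.equivFunOnFinite.symm fun i => (a i).toNat) else 0

lemma laurentCoeff_of_nonneg (ha : 0 ≤ a) (p : MvPolynomial (Fin n) K) :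
    laurentCoeff a p = coeff (Finsupp.equivFunOnFinite.symm fun i => (a i).toNat) p := by
  rw [laurentCoeff, if_pos ha, lcoeff_apply]

lemma laurentCoeff_of_not_nonneg (ha : ¬ 0 ≤ a) (p : MvPolynomial (Fin n) K) :
    laurentCoeff a p = 0 := by
  rw [laurentCoeff, if_neg ha, LinearMap.zero_apply]

lemma exists_of_laurentCoeff_ne_zero {p : MvPolynomial (Fin n) K} (h : laurentCoeff a p ≠ 0) :
    ∃ m ∈ p.support, a = fun i => (m i : ℤ) := by
  by_cases ha : 0 ≤ a
  · rw [laurentCoeff_of_nonneg ha] at h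
    refine ⟨_, mem_support_iff.2 h, funext fun i => ?_⟩
    have := ha i
    simp only [Pi.zero_apply] at this
    simp [this]
  · exact absurd (laurentCoeff_of_not_nonneg ha p) h

lemma laurentCoeff_natCast (m : Fin n →₀ ℕ) (p : MvPolynomial (Fin n) K) :
    laurentCoeff (fun i => (m i : ℤ)) p = coeff m p := by
  rw [laurentCoeff_of_nonneg fun i => by simp]
  congr 1
  ext i
  simp

lemma laurentCoeff_monomial_mul (a : Fin n → ℤ) (e : Fin n →₀ ℕ) (p : MvPolynomial (Fin n) K) :
    laurentCoeff (fun i => a i + e i) (monomial e 1 * p) = laurentCoeff a p := by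
  by_cases ha : 0 ≤ a
  · have hae : 0 ≤ fun i => a i + (e i : ℤ) := fun i => by
      have := ha i
      simp only [Pi.zero_apply] at this ⊢
      positivity
    have he : (Finsupp.equivFunOnFinite.symm fun i => (a i + (e i : ℤ)).toNat) =
        e + Finsupp.equivFunOnFinite.symm fun i => (a i).toNat := by
      ext i
      have := ha i
      simp only [Pi.zero_apply] at this
      simp only [Finsupp.equivFunOnFinite_symm_apply_apply, Finsupp.add_apply]
      omega
    rw [laurentCoeff_of_nonneg ha, laurentCoeff_of_nonneg hae, he, coeff_monomial_mul, one_mul]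
  · rw [laurentCoeff_of_not_nonneg ha]
    by_cases hae : 0 ≤ fun i => a i + (e i : ℤ)
    · rw [laurentCoeff_of_nonneg hae, coeff_monomial_mul', if_neg]
      intro hle
      refine ha fun i => ?_
      have h1 := hle i
      have h2 := hae i
      simp only [Pi.zero_apply, Finsupp.equivFunOnFinite_symm_apply_apply] at h1 h2 ⊢
      omega
    · rw [laurentCoeff_of_not_nonneg hae]

lemma laurentCoeff_eq_zero_of_mem (ha : ∀ u ∈ s, ∃ i, a i < u i) {p : MvPolynomial (Fin n) K}
    (hp : p ∈ monomialIdeal K s) : laurentCoeff a p = 0 := by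
  by_contra h
  obtain ⟨m, hm, rfl⟩ := exists_of_laurentCoeff_ne_zero h
  obtain ⟨u, hu, hle⟩ := mem_monomialIdeal.1 hp m hm
  obtain ⟨i, hi⟩ := ha u hu
  exact absurd (Nat.cast_lt.1 hi) (hle i).not_gt

lemma mem_genSubmonoid_X {v : MvPolynomial (Fin n) K} :
    v ∈ genSubmonoid X S ↔ ∃ e : Fin n →₀ ℕ, (∀ i ∉ S, e i = 0) ∧ v = monomial e 1 := by
  classical
  constructor
  · intro hv
    induction hv using Submonoid.closure_induction with
    | mem v hv =>
      obtain ⟨k, hk, rfl⟩ := hv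
      refine ⟨Finsupp.single k 1, fun i hi => Finsupp.single_eq_of_ne ?_, rfl⟩
      rintro rfl
      exact hi hk
    | one => exact ⟨0, fun _ _ => rfl, rfl⟩
    | mul v w _ _ hv hw =>
      obtain ⟨e, he, rfl⟩ := hv
      obtain ⟨f, hf, rfl⟩ := hw
      exact ⟨e + f, fun i hi => by simp [he i hi, hf i hi], by rw [monomial_mul, one_mul]⟩
  · rintro ⟨e, he, rfl⟩
    rw [monomial_eq, C_1, one_mul, Finsupp.prod]
    refine Submonoid.prod_mem _ fun i hi => Submonoid.pow_mem _ (Submonoid.subset_closure ?_) _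
    refine ⟨i, ?_, rfl⟩
    by_contra hiS
    exact Finsupp.mem_support_iff.1 hi (he i hiS)

/-- The element of `genSubmonoid X S` with exponent `e`, for `e` supported in `S`. -/
def denom {e : Fin n →₀ ℕ} (he : ∀ i ∉ S, e i = 0) :
    genSubmonoid (X : Fin n → MvPolynomial (Fin n) K) S :=
  ⟨monomial e 1, mem_genSubmonoid_X.2 ⟨e, he, rfl⟩⟩

/-- The localization of `K[X] / I` at the variables in `S`, where `I` is generated by the monomials
with exponents in `s`. -/
abbrev MonomialLoc (K : Type*) [Field K] (s : Set (Fin n →₀ ℕ)) (S : Finset (Fin n)) : Type _ :=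
  CechLoc (X : Fin n → MvPolynomial (Fin n) K) (MvPolynomial (Fin n) K ⧸ monomialIdeal K s) S

/-- The fraction `p / X ^ e`. -/
def fraction (s : Set (Fin n →₀ ℕ)) {e : Fin n →₀ ℕ} (he : ∀ i ∉ S, e i = 0)
    (p : MvPolynomial (Fin n) K) : MonomialLoc K s S :=
  LocalizedModule.mk (Submodule.mkQ _ p) (denom he)

lemma exists_eq_fraction (z : MonomialLoc K s S) :
    ∃ (e : Fin n →₀ ℕ) (he : ∀ i ∉ S, e i = 0) (p : MvPolynomial (Fin n) K),
      z = fraction s he p := by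
  induction z using LocalizedModule.induction_on with
  | h m v =>
    obtain ⟨v, hv⟩ := v
    obtain ⟨e, he, rfl⟩ := mem_genSubmonoid_X.1 hv
    obtain ⟨p, rfl⟩ := Submodule.mkQ_surjective _ m
    exact ⟨e, he, p, rfl⟩

lemma fraction_eq_fraction_iff {e f : Fin n →₀ ℕ} {he : ∀ i ∉ S, e i = 0} {hf : ∀ i ∉ S, f i = 0}
    {p q : MvPolynomial (Fin n) K} :
    fraction s he p = fraction s hf q ↔ ∃ g : Fin n →₀ ℕ, (∀ i ∉ S, g i = 0) ∧
      monomial g 1 * (monomial f 1 * p) - monomial g 1 * (monomial e 1 * q) ∈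
        monomialIdeal K s := by
  rw [fraction, fraction, LocalizedModule.mk_eq]
  constructor
  · rintro ⟨⟨v, hv⟩, h⟩
    obtain ⟨g, hg, rfl⟩ := mem_genSubmonoid_X.1 hv
    exact ⟨g, hg, (Submodule.Quotient.eq _).1 h⟩
  · rintro ⟨g, hg, h⟩
    exact ⟨denom hg, (Submodule.Quotient.eq _).2 h⟩

lemma fraction_add {e f : Fin n →₀ ℕ} (he : ∀ i ∉ S, e i = 0) (hf : ∀ i ∉ S, f i = 0)
    (p q : MvPolynomial (Fin n) K) :
    fraction s he p + fraction s hf q =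
      fraction s (e := e + f) (fun i hi => by simp [he i hi, hf i hi])
        (monomial f 1 * p + monomial e 1 * q) := by
  rw [fraction, fraction, LocalizedModule.mk_add_mk, fraction]
  congr 1
  refine Subtype.ext ?_
  simp [denom, monomial_mul]

lemma smul_fraction {e : Fin n →₀ ℕ} (he : ∀ i ∉ S, e i = 0) (c : K)
    (p : MvPolynomial (Fin n) K) : c • fraction s he p = fraction s he (c • p) := by
  rw [fraction, LocalizedModule.smul'_mk]
  rfl

lemma fraction_eq_zero_iff {e : Fin n →₀ ℕ} {he : ∀ i ∉ S, e i = 0}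
    {p : MvPolynomial (Fin n) K} :
    fraction s he p = 0 ↔ ∃ g : Fin n →₀ ℕ, (∀ i ∉ S, g i = 0) ∧
      monomial g 1 * p ∈ monomialIdeal K s := by
  have h0 : (0 : MonomialLoc K s S) = fraction s (e := 0) (fun _ _ => rfl) 0 := by
    rw [fraction, map_zero, LocalizedModule.zero_mk]
  rw [h0, fraction_eq_fraction_iff]
  have : (monomial (0 : Fin n →₀ ℕ) (1 : K)) = 1 := rfl
  simp only [this, one_mul, mul_zero, sub_zero]

lemma fraction_sum {e : Fin n →₀ ℕ} (he : ∀ i ∉ S, e i = 0) {ι : Type*} (t : Finset ι)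
    (p : ι → MvPolynomial (Fin n) K) :
    fraction s he (∑ i ∈ t, p i) = ∑ i ∈ t, fraction s he (p i) := by
  have h : ∀ p, fraction s he p = LocalizedModule.divBy (denom he)
      (LocalizedModule.mkLinearMap _ _ (Submodule.mkQ (monomialIdeal K s) p)) := fun p => by
    rw [LocalizedModule.mkLinearMap_apply, LocalizedModule.divBy_apply, LocalizedModule.liftOn_mk,
      fraction]
    dsimp only
    rw [one_mul]
  simp only [h, map_sum]

lemma cechLocMap_fraction (hST : S ⊆ T) {e : Fin n →₀ ℕ} (he : ∀ i ∉ S, e i = 0)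
    (p : MvPolynomial (Fin n) K) :
    cechLocMap X _ hST (fraction s he p) =
      fraction s (fun i hi => he i fun h => hi (hST h)) p := by
  rw [fraction, fraction, cechLocMap, IsLocalizedModule.mk_eq_mk', IsLocalizedModule.mk_eq_mk',
    IsLocalizedModule.liftOfLE_mk']
  rfl

open Classical in
/-- The coefficient of a fraction at the multidegree `a`, as a function. -/
def coefficientFun (s : Set (Fin n →₀ ℕ)) (S : Finset (Fin n)) (a : Fin n → ℤ)
    (z : MonomialLoc K s S) : K :=
  if Survives s S a then
    laurentCoeff (fun i => a i + (exists_eq_fraction z).choose i)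
      (exists_eq_fraction z).choose_spec.choose_spec.choose
  else 0

lemma Survives.exists_lt (ha : Survives s S a) {e : Fin n →₀ ℕ} (he : ∀ i ∉ S, e i = 0) :
    ∀ u ∈ s, ∃ i, a i + e i < u i := fun u hu => by
  obtain ⟨i, hi, hlt⟩ := ha.2 u hu
  exact ⟨i, by simpa [he i hi] using hlt⟩

/-- Independence of the chosen representative. Equal fractions agree modulo `I` after multiplication
by monomials in the variables of `S`; such shifts do not affect survival, so the shifted coefficient
functional vanishes on `I`. -/
lemma coefficientFun_fraction (ha : Survives s S a) {e : Fin n →₀ ℕ} (he : ∀ i ∉ S, e i = 0)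
    (p : MvPolynomial (Fin n) K) :
    coefficientFun s S a (fraction s he p) = laurentCoeff (fun i => a i + e i) p := by
  rw [coefficientFun, if_pos ha]
  set z := fraction s he p with hz
  set f := (exists_eq_fraction z).choose
  set hf : ∀ i ∉ S, f i = 0 := (exists_eq_fraction z).choose_spec.choose
  set q := (exists_eq_fraction z).choose_spec.choose_spec.choose
  have hq : fraction s he p = fraction s hf q :=
    (exists_eq_fraction z).choose_spec.choose_spec.choose_spec
  obtain ⟨g, hg, hmem⟩ := fraction_eq_fraction_iff.1 hq
  have h0 := laurentCoeff_eq_zero_of_mem (a := fun i => a i + ((e + f + g : Fin n →₀ ℕ) i : ℤ))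
    (ha.exists_lt fun i hi => by simp [he i hi, hf i hi, hg i hi]) hmem
  rw [map_sub, sub_eq_zero] at h0
  have e1 : (fun i => a i + ((e + f + g : Fin n →₀ ℕ) i : ℤ)) =
      fun i => (fun i => (fun i => a i + (e i : ℤ)) i + (f i : ℤ)) i + (g i : ℤ) := by
    funext i; simp; ring
  have e2 : (fun i => a i + ((e + f + g : Fin n →₀ ℕ) i : ℤ)) =
      fun i => (fun i => (fun i => a i + (f i : ℤ)) i + (e i : ℤ)) i + (g i : ℤ) := by
    funext i; simp; ring
  conv_lhs at h0 => rw [e1, laurentCoeff_monomial_mul, laurentCoeff_monomial_mul]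
  conv_rhs at h0 => rw [e2, laurentCoeff_monomial_mul, laurentCoeff_monomial_mul]
  exact h0.symm

lemma coefficientFun_of_not_survives (ha : ¬ Survives s S a) (z : MonomialLoc K s S) :
    coefficientFun s S a z = 0 := if_neg ha

/-- The coefficient of an element of the localization at the multidegree `a`. -/
def coefficient (s : Set (Fin n →₀ ℕ)) (S : Finset (Fin n)) (a : Fin n → ℤ) :
    MonomialLoc K s S →ₗ[K] K where
  toFun := coefficientFun s S a
  map_add' z w := by
    by_cases ha : Survives s S a
    · obtain ⟨e, he, p, rfl⟩ := exists_eq_fraction z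
      obtain ⟨f, hf, q, rfl⟩ := exists_eq_fraction w
      rw [fraction_add, coefficientFun_fraction ha, coefficientFun_fraction ha,
        coefficientFun_fraction ha, map_add]
      have e1 : (fun i => a i + ((e + f : Fin n →₀ ℕ) i : ℤ)) =
          fun i => (fun i => a i + (e i : ℤ)) i + (f i : ℤ) := by
        funext i; simp; ring
      have e2 : (fun i => a i + ((e + f : Fin n →₀ ℕ) i : ℤ)) =
          fun i => (fun i => a i + (f i : ℤ)) i + (e i : ℤ) := by
        funext i; simp; ring
      congr 1
      · rw [e1, laurentCoeff_monomial_mul]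
      · rw [e2, laurentCoeff_monomial_mul]
    · simp only [coefficientFun_of_not_survives ha, add_zero]
  map_smul' c z := by
    by_cases ha : Survives s S a
    · obtain ⟨e, he, p, rfl⟩ := exists_eq_fraction z
      rw [smul_fraction, coefficientFun_fraction ha, coefficientFun_fraction ha, map_smul,
        RingHom.id_apply]
    · simp only [coefficientFun_of_not_survives ha, smul_zero]

lemma coefficient_fraction (ha : Survives s S a) {e : Fin n →₀ ℕ} (he : ∀ i ∉ S, e i = 0)
    (p : MvPolynomial (Fin n) K) :
    coefficient s S a (fraction s he p) = laurentCoeff (fun i => a i + e i) p :=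
  coefficientFun_fraction ha he p

lemma coefficient_of_not_survives (ha : ¬ Survives s S a) (z : MonomialLoc K s S) :
    coefficient s S a z = 0 := if_neg ha

/-- Each term of the numerator dies separately: its multidegree does not survive, so some generator
divides it up to variables in `S`, and these are invertible. -/
lemma eq_zero_of_coefficient {z : MonomialLoc K s S} (h : ∀ a, coefficient s S a z = 0) :
    z = 0 := by
  obtain ⟨e, he, p, rfl⟩ := exists_eq_fraction z
  rw [← support_sum_monomial_coeff p, fraction_sum]
  refine sum_eq_zero fun m hm => fraction_eq_zero_iff.2 ?_
  set a : Fin n → ℤ := fun i => m i - e i with ha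
  have hG : negSupport a ⊆ S := fun i hi => by
    by_contra hiS
    have := mem_negSupport.1 hi
    simp only [ha, he i hiS] at this
    omega
  have hns : ¬ Survives s S a := fun hs => by
    have h1 := h a
    rw [coefficient_fraction hs] at h1
    have : (fun i => a i + (e i : ℤ)) = fun i => (m i : ℤ) := by funext i; simp [ha]
    rw [this, laurentCoeff_natCast] at h1
    exact mem_support_iff.1 hm h1
  obtain ⟨u, hu, hle⟩ := (not_survives_iff hG).1 hns
  -- The part of the generator in the variables of `S` supplies the missing factor.
  refine ⟨u.filter (· ∈ S), fun i hi => Finsupp.filter_apply_neg _ _ hi, ?_⟩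
  rw [monomial_mul, one_mul, monomial_mem_monomialIdeal (mem_support_iff.1 hm)]
  refine ⟨u, hu, fun i => ?_⟩
  rw [Finsupp.add_apply]
  by_cases hi : i ∈ S
  · rw [Finsupp.filter_apply_pos _ _ hi]
    omega
  · have := hle i hi
    simp only [ha, he i hi] at this
    omega

lemma ext_coefficient {z w : MonomialLoc K s S}
    (h : ∀ a, coefficient s S a z = coefficient s S a w) : z = w :=
  sub_eq_zero.1 (eq_zero_of_coefficient fun a => by rw [map_sub, h, sub_self])

lemma finite_coefficient_ne_zero (z : MonomialLoc K s S) :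
    {a | coefficient s S a z ≠ 0}.Finite := by
  obtain ⟨e, he, p, rfl⟩ := exists_eq_fraction z
  refine (p.support.finite_toSet.image fun m => fun i => (m i : ℤ) - e i).subset fun a ha => ?_
  have hs : Survives s S a := by
    by_contra hs
    exact ha (coefficient_of_not_survives hs _)
  rw [Set.mem_ofPred_eq, coefficient_fraction hs] at ha
  obtain ⟨m, hm, h⟩ := exists_of_laurentCoeff_ne_zero ha
  refine ⟨m, hm, funext fun i => ?_⟩
  have := congrFun h i
  simp only at this ⊢
  omega

-- If `a` survives in `T` but not in `S`, it is negative at some index outside `S`. A denominator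
-- from `S` cannot produce this, so the coefficient on the left is zero as well.
open Classical in
lemma coefficient_cechLocMap (hST : S ⊆ T) (a : Fin n → ℤ) (z : MonomialLoc K s S) :
    coefficient s T a (cechLocMap X _ hST z) =
      if Survives s T a then coefficient s S a z else 0 := by
  obtain ⟨e, he, p, rfl⟩ := exists_eq_fraction z
  split_ifs with hT
  · rw [cechLocMap_fraction, coefficient_fraction hT]
    by_cases hS : Survives s S a
    · rw [coefficient_fraction hS]
    · rw [coefficient_of_not_survives hS, laurentCoeff_of_not_nonneg]
      intro h
      refine hS (hT.anti hST fun i hi => ?_)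
      by_contra hiS
      have h1 := h i
      have h2 := mem_negSupport.1 hi
      simp only [Pi.zero_apply, he i hiS] at h1
      omega
  · exact coefficient_of_not_survives hT _

/-! ### Homogeneous fractions -/

lemma monomial_mem_polyGrading_iff {m : Fin n →₀ ℕ} {c : K} (hc : c ≠ 0) {d : ℤ} :
    monomial m c ∈ polyGrading K d ↔ ∑ i, (m i : ℤ) = d := by
  classical
  rw [polyGrading, mem_weightedHomogeneousSubmodule]
  have hw : Finsupp.weight (fun _ : Fin n => (1 : ℤ)) m = ∑ i, (m i : ℤ) := by
    rw [Finsupp.weight_apply, Finsupp.sum_fintype _ _ (by simp)]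
    simp
  rw [← hw]
  constructor
  · intro h
    exact h (by rwa [coeff_monomial, if_pos rfl])
  · exact isWeightedHomogeneous_monomial _ _ _

lemma sum_eq_of_laurentCoeff_ne_zero {p : MvPolynomial (Fin n) K} {d : ℤ}
    (hp : p ∈ polyGrading K d) (h : laurentCoeff a p ≠ 0) : ∑ i, a i = d := by
  obtain ⟨m, hm, rfl⟩ := exists_of_laurentCoeff_ne_zero h
  have := hp (mem_support_iff.1 hm)
  rw [← this, Finsupp.weight_apply, Finsupp.sum_fintype _ _ (by simp)]
  simp

/-- The part of degree `j` of the localization of `K[X] / I` at the variables in `S`. -/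
abbrev monomialLocGrading (K : Type*) [Field K] (s : Set (Fin n →₀ ℕ)) (S : Finset (Fin n))
    (j : ℤ) : Submodule K (MonomialLoc K s S) :=
  cechLocGrading X (polyGrading K) (quotGrading (monomialIdeal K s)) S j

lemma coefficient_eq_zero_of_mem {j : ℤ} {z : MonomialLoc K s S}
    (hz : z ∈ monomialLocGrading K s S j) (ha : ∑ i, a i ≠ j) : coefficient s S a z = 0 := by
  by_cases hs : Survives s S a
  swap
  · exact coefficient_of_not_survives hs z
  have hle : monomialLocGrading K s S j ≤ LinearMap.ker (coefficient s S a) := by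
    refine Submodule.span_le.2 ?_
    rintro _ ⟨d, d', m, ⟨v, hv⟩, ⟨p, hp, rfl⟩, hd', rfl, rfl⟩
    obtain ⟨e, he, rfl⟩ := mem_genSubmonoid_X.1 hv
    by_contra h
    refine ha ?_
    change ¬ coefficient s S a (fraction s he p) = 0 at h
    rw [coefficient_fraction hs] at h
    have h1 := sum_eq_of_laurentCoeff_ne_zero hp h
    have h2 := (monomial_mem_polyGrading_iff one_ne_zero).1 hd'
    rw [sum_add_distrib, h2] at h1
    omega
  exact hle hz

open Classical in
lemma exists_coefficient_single (s : Set (Fin n →₀ ℕ)) (S : Finset (Fin n)) (a : Fin n → ℤ)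
    (c : K) : ∃ z ∈ monomialLocGrading K s S (∑ i, a i), ∀ b, coefficient s S b z =
      if Survives s S b then (Finsupp.single a c) b else 0 := by
  by_cases ha : Survives s S a
  · have he : ∀ i ∉ S, (Finsupp.equivFunOnFinite.symm fun i => (-a i).toNat) i = 0 := by
      intro i hi
      have := ha.1 i hi
      simpa using this
    -- The witness is `c` times `X ^ a⁺ / X ^ a⁻`; survival puts the support of `a⁻` inside `S`.
    set e : Fin n →₀ ℕ := Finsupp.equivFunOnFinite.symm fun i => (-a i).toNat with hedef
    set m : Fin n →₀ ℕ := Finsupp.equivFunOnFinite.symm fun i => (a i).toNat with hm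
    have hme : ∀ i, (m i : ℤ) = a i + e i := fun i => by
      simp only [hm, hedef, Finsupp.equivFunOnFinite_symm_apply_apply]
      omega
    by_cases hc : c = 0
    · exact ⟨0, Submodule.zero_mem _, fun b => by simp [hc]⟩
    refine ⟨fraction s he (monomial m c), Submodule.subset_span ?_, fun b => ?_⟩
    · refine ⟨∑ i, (m i : ℤ), ∑ i, (e i : ℤ), _, denom he,
        ⟨monomial m c, (monomial_mem_polyGrading_iff hc).2 rfl, rfl⟩,
        (monomial_mem_polyGrading_iff one_ne_zero).2 rfl, ?_, rfl⟩
      simp [hme, sum_add_distrib]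
    · split_ifs with hb
      · rw [coefficient_fraction hb]
        by_cases hab : a = b
        · subst hab
          rw [Finsupp.single_eq_same, ← funext hme, laurentCoeff_natCast, coeff_monomial,
            if_pos rfl]
        · rw [Finsupp.single_eq_of_ne' hab]
          by_contra h
          obtain ⟨m', hm', h'⟩ := exists_of_laurentCoeff_ne_zero h
          have : m' = m := by simpa using support_monomial_subset hm'
          refine hab (funext fun i => ?_)
          have h1 := congrFun h' i
          have h2 := hme i
          simp only [this] at h1
          omega
      · exact coefficient_of_not_survives hb _
  · refine ⟨0, Submodule.zero_mem _, fun b => ?_⟩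
    rw [map_zero]
    split_ifs with hb
    · rw [Finsupp.single_eq_of_ne]
      rintro rfl
      exact ha hb
    · rfl

open Classical in
/-- Every finitely supported family is the family of coefficients of an element. -/
lemma exists_coefficient_eq (s : Set (Fin n →₀ ℕ)) (S : Finset (Fin n)) {f : (Fin n → ℤ) → K}
    (hf : {a | f a ≠ 0}.Finite) : ∃ z : MonomialLoc K s S,
      (∀ a, coefficient s S a z = if Survives s S a then f a else 0) ∧
      ∀ j, (∀ a, f a ≠ 0 → ∑ i, a i = j) → z ∈ monomialLocGrading K s S j := by
  choose z hz hz' using fun a => exists_coefficient_single s S a (f a)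
  refine ⟨∑ a ∈ hf.toFinset, z a, fun b => ?_, fun j hj => Submodule.sum_mem _ fun a ha => ?_⟩
  · rw [map_sum]
    simp only [hz']
    split_ifs
    · by_cases hb : f b = 0
      · rw [hb]
        refine sum_eq_zero fun a ha => Finsupp.single_eq_of_ne ?_
        rintro rfl
        exact (hf.mem_toFinset.1 ha) hb
      · rw [sum_eq_single_of_mem b (hf.mem_toFinset.2 hb), Finsupp.single_eq_same]
        intro a _ hab
        exact Finsupp.single_eq_of_ne' hab
    · exact sum_const_zero
  · have := hj a (hf.mem_toFinset.1 ha)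
    subst this
    exact hz a

end Coefficients

/-! ### Local cohomology of quasi-stable monomial ideals -/

section Cohomology

variable {n : ℕ} {K : Type*} [Field K] {s : Set (Fin n →₀ ℕ)} {p : ℕ} {j : ℤ}

/-- The Čech cochains of `K[X] / I`, where `I` is generated by the monomials with exponents
in `s`. -/
abbrev MonomialCochain (K : Type*) [Field K] (s : Set (Fin n →₀ ℕ)) (p : ℕ) : Type _ :=
  CechCochain (X : Fin n → MvPolynomial (Fin n) K) (MvPolynomial (Fin n) K ⧸ monomialIdeal K s) p

/-- The coefficients of a cochain at the multidegree `a`, extended by zero to all `S`. -/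
def scalarCochain (c : MonomialCochain K s p) (a : Fin n → ℤ) (S : Finset (Fin n)) : K :=
  if h : S.card = p then coefficient s S a (c ⟨S, h⟩) else 0

lemma scalarCochain_of_card (c : MonomialCochain K s p) (a : Fin n → ℤ) {S : Finset (Fin n)}
    (h : S.card = p) : scalarCochain c a S = coefficient s S a (c ⟨S, h⟩) := dif_pos h

lemma scalarCochain_of_not_survives (c : MonomialCochain K s p) {a : Fin n → ℤ}
    {S : Finset (Fin n)} (h : ¬ Survives s S a) : scalarCochain c a S = 0 := by
  rw [scalarCochain]
  split_ifs
  · exact coefficient_of_not_survives h _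
  · rfl

lemma scalarCochain_add (c c' : MonomialCochain K s p) (a : Fin n → ℤ) (S : Finset (Fin n)) :
    scalarCochain (c + c') a S = scalarCochain c a S + scalarCochain c' a S := by
  simp only [scalarCochain]
  split_ifs with h
  · exact map_add _ _ _
  · exact (add_zero 0).symm

lemma scalarCochain_smul (r : K) (c : MonomialCochain K s p) (a : Fin n → ℤ)
    (S : Finset (Fin n)) : scalarCochain (r • c) a S = r * scalarCochain c a S := by
  simp only [scalarCochain]
  split_ifs with h
  · exact (coefficient s S a).map_smul r (c ⟨S, h⟩)
  · exact (mul_zero r).symm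

lemma ext_scalarCochain {c c' : MonomialCochain K s p}
    (h : ∀ a S, S.card = p → scalarCochain c a S = scalarCochain c' a S) : c = c' := by
  funext ⟨S, hS⟩
  refine ext_coefficient fun a => ?_
  rw [← scalarCochain_of_card c a hS, ← scalarCochain_of_card c' a hS, h a S hS]

lemma finite_scalarCochain_ne_zero (c : MonomialCochain K s p) (S : Finset (Fin n)) :
    {a | scalarCochain c a S ≠ 0}.Finite := by
  by_cases h : S.card = p
  · simp only [scalarCochain_of_card c _ h]
    exact finite_coefficient_ne_zero _
  · simp [scalarCochain, h]

-- The splitting of the Čech complex into scalar complexes. Faces that do not survive need no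
-- exclusion from the sum, since the scalar cochain is zero there.
open Classical in
lemma scalarCochain_cechD (c : MonomialCochain K s p) (a : Fin n → ℤ) {T : Finset (Fin n)}
    (hT : T.card = p + 1) :
    scalarCochain (cechD X _ p c) a T =
      if Survives s T a then ∑ k ∈ T, faceSign K T k * scalarCochain c a (T.erase k) else 0 := by
  rw [scalarCochain_of_card _ _ hT, cechD_apply, map_sum, ← sum_coe_sort T]
  -- The signs of the Čech differential lie in the polynomial ring, while coefficients are only
  -- `K`-linear.
  have h : ∀ (k : ℕ) (z : MonomialLoc K s T),
      ((-1 : MvPolynomial (Fin n) K) ^ k) • z = ((-1 : K) ^ k) • z := by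
    intro k z
    rcases neg_one_pow_eq_or (MvPolynomial (Fin n) K) k with h | h <;>
      rcases Nat.even_or_odd k with hk | hk <;> simp [hk.neg_one_pow]
  split_ifs with hs
  · refine sum_congr rfl fun k _ => ?_
    rw [h, map_smul, coefficient_cechLocMap, if_pos hs, scalarCochain_of_card, smul_eq_mul,
      faceSign]
  · exact sum_eq_zero fun k _ => coefficient_of_not_survives hs _

lemma scalarCochain_eq_zero_of_mem {c : MonomialCochain K s p}
    (hc : c ∈ cechGrading X (polyGrading K) (quotGrading (monomialIdeal K s)) p j)
    {a : Fin n → ℤ} (ha : ∑ i, a i ≠ j) (S : Finset (Fin n)) : scalarCochain c a S = 0 := by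
  rw [scalarCochain]
  split_ifs with h
  · exact coefficient_eq_zero_of_mem (hc ⟨S, h⟩ (Set.mem_univ _)) ha
  · rfl

open Classical in
/-- Every family of scalar cochains with finite supports comes from a cochain. -/
lemma exists_scalarCochain_eq (s : Set (Fin n →₀ ℕ)) (p : ℕ)
    {f : (Fin n → ℤ) → Finset (Fin n) → K} (hf : ∀ S, {a | f a S ≠ 0}.Finite) :
    ∃ c : MonomialCochain K s p, (∀ a S, S.card = p → scalarCochain c a S =
      if Survives s S a then f a S else 0) ∧
      ∀ j, (∀ a S, f a S ≠ 0 → ∑ i, a i = j) →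
        c ∈ cechGrading X (polyGrading K) (quotGrading (monomialIdeal K s)) p j := by
  choose z hz hz' using fun S => exists_coefficient_eq s S (hf S)
  refine ⟨fun S => z S.1, fun a S hS => ?_, fun j hj S _ => hz' S.1 j fun a => hj a S.1⟩
  rw [scalarCochain_of_card _ _ hS, hz]

/-- The cocycles of degree `j`. -/
abbrev gradedCocycles (K : Type*) [Field K] (s : Set (Fin n →₀ ℕ)) (p : ℕ) (j : ℤ) :
    Submodule K (cechCocycles (X : Fin n → MvPolynomial (Fin n) K)
      (MvPolynomial (Fin n) K ⧸ monomialIdeal K s) p) :=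
  (cechGrading X (polyGrading K) (quotGrading (monomialIdeal K s)) p j).comap
    ((cechCocycles X _ p).subtype.restrictScalars K)

/-- The class of a cocycle of degree `j` in local cohomology. -/
def cocycleClass (K : Type*) [Field K] (s : Set (Fin n →₀ ℕ)) (p : ℕ) (j : ℤ) :
    gradedCocycles K s p j →ₗ[K] localCohomologyGrading (monomialIdeal K s) p j :=
  (((cechCoboundaries X _ p).comap (cechCocycles X _ p).subtype).mkQ.restrictScalars K).submoduleMap
    (gradedCocycles K s p j)

lemma cocycleClass_surjective (K : Type*) [Field K] (s : Set (Fin n →₀ ℕ)) (p : ℕ) (j : ℤ) :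
    Function.Surjective (cocycleClass K s p j) :=
  LinearMap.submoduleMap_surjective _ _

lemma cocycleClass_eq_zero_iff (z : gradedCocycles K s p j) :
    cocycleClass K s p j z = 0 ↔
      (z.1.1 : MonomialCochain K s p) ∈ cechCoboundaries X _ p := by
  rw [← Subtype.coe_inj]
  exact Submodule.Quotient.mk_eq_zero _

/-- The coefficients of a cocycle at the multidegrees that contribute to cohomology. -/
def cocycleCoefficients (K : Type*) [Field K] (s : Set (Fin n →₀ ℕ)) (p : ℕ) (j : ℤ) :
    gradedCocycles K s p j →ₗ[K] (cohomologyDegrees s p j → K) where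
  toFun z a := scalarCochain z.1.1 a.1 (negSupport a.1)
  map_add' z w := funext fun a => scalarCochain_add z.1.1 w.1.1 a.1 _
  map_smul' r z := funext fun a => scalarCochain_smul r z.1.1 a.1 _

lemma cocycleCoefficients_apply (z : gradedCocycles K s p j) (a : cohomologyDegrees s p j) :
    cocycleCoefficients K s p j z a = scalarCochain z.1.1 a.1 (negSupport a.1) := rfl

/-- Prescribed values are placed on the negative supports. The cochain is a cocycle because nothing
larger than the negative support survives at these multidegrees. -/
lemma cocycleCoefficients_surjective (K : Type*) [Field K] (s : Set (Fin n →₀ ℕ)) (p : ℕ)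
    (j : ℤ) : Function.Surjective (cocycleCoefficients K s p j) := by
  classical
  intro f
  obtain ⟨c, hc, hj⟩ := exists_scalarCochain_eq s p
    (f := fun a S => if h : a ∈ cohomologyDegrees s p j then
      if S = negSupport a then f ⟨a, h⟩ else 0 else 0)
    (fun S => (finite_cohomologyDegrees s p j).subset fun a ha => by
      by_contra h
      exact ha (dif_neg h))
  have hcoc : c ∈ cechCocycles X _ p := by
    refine LinearMap.mem_ker.2 (ext_scalarCochain fun a T hT => ?_)
    have h0 : scalarCochain (0 : MonomialCochain K s (p + 1)) a T = 0 := by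
      rw [scalarCochain_of_card _ _ hT]
      exact map_zero _
    rw [h0, scalarCochain_cechD c a hT]
    split_ifs with hs
    · refine sum_eq_zero fun k hk => ?_
      rw [hc _ _ (by rw [card_erase_of_mem hk, hT, Nat.add_sub_cancel])]
      split_ifs with hs' ha hG
      · exact absurd hk (erase_eq_self.1 (((ha.2.2 T).1 hs).trans hG.symm).symm)
      all_goals exact mul_zero _
    · rfl
  refine ⟨⟨⟨c, hcoc⟩, hj j fun a S h => ?_⟩, funext fun a => ?_⟩
  · by_contra ha
    exact h (dif_neg fun h' => ha h'.1)
  · rw [cocycleCoefficients_apply, hc _ _ a.2.2.1, if_pos ((a.2.2.2 _).2 rfl), dif_pos a.2,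
      if_pos rfl]

/-- At a contributing multidegree no proper subset of the negative support survives, so there are no
cochains one degree lower. -/
lemma cocycleCoefficients_eq_zero_of_mem_coboundaries {z : gradedCocycles K s p j}
    (hz : (z.1.1 : MonomialCochain K s p) ∈ cechCoboundaries X _ p) :
    cocycleCoefficients K s p j z = 0 := by
  classical
  funext a
  rw [cocycleCoefficients_apply, Pi.zero_apply]
  cases p with
  | zero =>
    rw [(Submodule.mem_bot _).1 hz, scalarCochain_of_card _ _ a.2.2.1]
    exact map_zero _
  | succ p =>
    obtain ⟨y, hy⟩ := hz
    rw [← hy, scalarCochain_cechD y _ a.2.2.1]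
    split_ifs
    · refine sum_eq_zero fun k hk => ?_
      rw [scalarCochain_of_not_survives, mul_zero]
      intro h
      have := (a.2.2.2 _).1 h
      exact notMem_erase k (negSupport a.1) (this.symm ▸ hk)
    · rfl

/-- By the trichotomy, at each multidegree either the family is a cone and the contraction gives a
primitive, or the cocycle has no coefficients there. Finiteness of supports allows the primitives to
be assembled into one cochain. -/
lemma IsQuasiStable.mem_coboundaries (hs : IsQuasiStable s) {z : gradedCocycles K s p j}
    (hz : cocycleCoefficients K s p j z = 0) :
    (z.1.1 : MonomialCochain K s p) ∈ cechCoboundaries X _ p := by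
  classical
  set c : MonomialCochain K s p := z.1.1 with hc
  have hcoc : cechD X _ p c = 0 := z.1.2
  have hcone : ∀ a, (∃ q, ∀ S, Survives s (insert q S) a ↔ Survives s S a) ∨
      ∀ S, S.card = p → scalarCochain c a S = 0 := by
    intro a
    rcases hs.trichotomy a with h | h | h
    · exact Or.inl h
    · right
      intro S hS
      by_cases hSG : S = negSupport a
      · by_cases ha : ∑ i, a i = j
        · subst hSG
          exact congrFun hz ⟨a, ha, hS, h⟩
        · exact scalarCochain_eq_zero_of_mem z.2 ha S
      · exact scalarCochain_of_not_survives c fun h' => hSG ((h S).1 h')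
    · exact Or.inr fun S _ => scalarCochain_of_not_survives c (h S)
  have hsum : ∀ a q, (∀ S, Survives s (insert q S) a ↔ Survives s S a) →
      ∀ T : Finset (Fin n), T.card = p → Survives s T a →
      ∑ k ∈ T, faceSign K T k * coneContraction q (scalarCochain c a) (T.erase k) =
        scalarCochain c a T := by
    intro a q hq T hT hTs
    refine sum_coneContraction fun hqT => ?_
    have := scalarCochain_cechD c a (T := insert q T) (by rw [card_insert_of_notMem hqT, hT])
    rw [if_pos ((hq T).2 hTs), hcoc] at this
    rw [← this, scalarCochain_of_card _ _ (by rw [card_insert_of_notMem hqT, hT])]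
    exact map_zero _
  cases p with
  | zero =>
    refine (Submodule.mem_bot _).2 (ext_scalarCochain fun a S hS => ?_)
    have h0 : scalarCochain (0 : MonomialCochain K s 0) a S = 0 := by
      rw [scalarCochain_of_card _ _ hS]
      exact map_zero _
    rw [h0]
    rcases hcone a with ⟨q, hq⟩ | h
    · by_cases hSs : Survives s S a
      -- In degree 0 the contraction formula is a sum over the empty set, so the coefficient
      -- vanishes.
      · rw [← hsum a q hq S hS hSs, card_eq_zero.1 hS, sum_empty]
      · exact scalarCochain_of_not_survives c hSs
    · exact h S hS
  | succ p =>
    obtain ⟨y, hy, -⟩ := exists_scalarCochain_eq s p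
      (f := fun a S => if h : ∃ q, ∀ S, Survives s (insert q S) a ↔ Survives s S a then
        coneContraction h.choose (scalarCochain c a) S else 0)
      -- The apex varies with `a`, but it ranges over finitely many indices, so the support on `S`
      -- lies in a finite union of finite sets.
      (fun S => (Set.finite_iUnion fun q => finite_scalarCochain_ne_zero c (insert q S)).subset
        fun a ha => by
          rw [Set.mem_ofPred_eq] at ha
          split_ifs at ha with h
          · refine Set.mem_iUnion.2 ⟨h.choose, fun h0 => ha ?_⟩
            rw [coneContraction, h0, mul_zero, ite_self]
          · exact absurd rfl ha)
    refine ⟨y, ext_scalarCochain fun a T hT => ?_⟩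
    rw [scalarCochain_cechD y a hT]
    split_ifs with hTs
    · have hcard : ∀ k ∈ T, (T.erase k).card = p := fun k hk => by
        rw [card_erase_of_mem hk, hT, Nat.add_sub_cancel]
      by_cases h : ∃ q, ∀ S, Survives s (insert q S) a ↔ Survives s S a
      · rw [← hsum a h.choose h.choose_spec T hT hTs]
        refine sum_congr rfl fun k hk => ?_
        rw [hy _ _ (hcard k hk), dif_pos h]
        split_ifs with hk'
        · rfl
        -- If the face does not survive, neither does its join with the apex, so the contraction
        -- already vanishes and truncation to survivors changes nothing.
        · rw [coneContraction, scalarCochain_of_not_survives c (fun h' =>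
            hk' ((h.choose_spec _).1 h'))]
          simp
      · rw [(hcone a).resolve_left h T hT]
        refine sum_eq_zero fun k hk => ?_
        rw [hy _ _ (hcard k hk), dif_neg h, ite_self, mul_zero]
    · exact (scalarCochain_of_not_survives c hTs).symm

lemma IsQuasiStable.cocycleClass_eq_zero_iff (hs : IsQuasiStable s) (z : gradedCocycles K s p j) :
    cocycleClass K s p j z = 0 ↔ cocycleCoefficients K s p j z = 0 := by
  rw [GradedLC.cocycleClass_eq_zero_iff]
  exact ⟨cocycleCoefficients_eq_zero_of_mem_coboundaries, hs.mem_coboundaries⟩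

/-- Two surjective linear maps with the same kernel have isomorphic targets. -/
def equivOfKerEq {V W U : Type*} [AddCommGroup V] [AddCommGroup W] [AddCommGroup U] [Module K V]
    [Module K W] [Module K U] (f : V →ₗ[K] W) (g : V →ₗ[K] U) (hf : Function.Surjective f)
    (hg : Function.Surjective g) (h : ∀ v, f v = 0 ↔ g v = 0) : W ≃ₗ[K] U :=
  (f.quotKerEquivOfSurjective hf).symm.trans
    ((Submodule.quotEquivOfEq _ _ (Submodule.ext h)).trans (g.quotKerEquivOfSurjective hg))

/-- For a quasi-stable set of exponents, the part of degree `j` of the `p`-th local cohomology has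
a basis indexed by `cohomologyDegrees s p j`. -/
def IsQuasiStable.localCohomologyEquiv (hs : IsQuasiStable s) (K : Type*) [Field K] (p : ℕ)
    (j : ℤ) : localCohomologyGrading (monomialIdeal K s) p j ≃ₗ[K] (cohomologyDegrees s p j → K) :=
  equivOfKerEq (V := gradedCocycles K s p j) (cocycleClass K s p j) (cocycleCoefficients K s p j)
    (cocycleClass_surjective K s p j) (cocycleCoefficients_surjective K s p j)
    fun z => hs.cocycleClass_eq_zero_iff z

lemma IsQuasiStable.finite_localCohomologyGrading (hs : IsQuasiStable s) (K : Type*) [Field K]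
    (p : ℕ) (j : ℤ) : Module.Finite K (localCohomologyGrading (monomialIdeal K s) p j) := by
  have := (finite_cohomologyDegrees s p j).to_subtype
  exact Module.Finite.equiv (hs.localCohomologyEquiv K p j).symm

lemma IsQuasiStable.hilbertFunction_localCohomologyGrading (hs : IsQuasiStable s) (K : Type*)
    [Field K] (p : ℕ) (j : ℤ) :
    hilbertFunction (localCohomologyGrading (monomialIdeal K s) p) j =
      (cohomologyDegrees s p j).ncard := by
  have := (finite_cohomologyDegrees s p j).fintype
  rw [hilbertFunction, (hs.localCohomologyEquiv K p j).finrank_eq, Module.finrank_fintype_fun_eq_card,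
    Set.ncard_eq_toFinset_card', Set.toFinset_card]

end Cohomology

end GradedLC

end

theorem mainTheorem4 {n : ℕ} {K : Type*} [Field K] (s : Set (Fin n →₀ ℕ))
    (hI : IsWeaklyStable (monomialIdeal K s)) (i : ℕ) :
    -- the graded pieces over `K` and over `ℚ` are finite-dimensional, of the same dimension
    (∀ j : ℤ, Module.Finite K (localCohomologyGrading (monomialIdeal K s) i j)) ∧
    (∀ j : ℤ, Module.Finite ℚ (localCohomologyGrading (monomialIdeal ℚ s) i j)) ∧
    hilbertFunction (localCohomologyGrading (monomialIdeal K s) i) =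
      hilbertFunction (localCohomologyGrading (monomialIdeal ℚ s) i) ∧
    -- and so over every other field
    ∀ (L : Type*) [Field L],
      (∀ j : ℤ, Module.Finite L (localCohomologyGrading (monomialIdeal L s) i j)) ∧
      hilbertFunction (localCohomologyGrading (monomialIdeal K s) i) =
        hilbertFunction (localCohomologyGrading (monomialIdeal L s) i) := by
  -- Quasi-stability no longer mentions a field, so a hypothesis over `K` yields the count over
  -- every field.
  have hs := hI.isQuasiStable
  refine ⟨hs.finite_localCohomologyGrading K i, hs.finite_localCohomologyGrading ℚ i,
    funext fun j => ?_, fun L _ => ⟨hs.finite_localCohomologyGrading L i, funext fun j => ?_⟩⟩ <;>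
    simp only [hs.hilbertFunction_localCohomologyGrading]
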